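/- Let $n\ge 2$ and let $(G,f)$ be a finite $n$-ary group: $G$ is a non-empty finite set and $f:G^n\to G$ is an associative operation (all the ways of applying $f$ twice to a sequence $x_1,\dots,x_{2n-1}$ agree) such that for every $i\in\{1,\dots,n\}$ and all $x_0,x_1,\dots,x_n\in G$ there is a unique $z\in G$ with $f(x_1,\dots,x_{i-1},z,x_{i+1},\dots,x_n)=x_0$. A representation of $(G,f)$ of degree $m$ is a map $\Lambda:G\to GL_m(\mathbb C)$ with $\Lambda(f(x_1,\dots,x_n))=\Lambda(x_1)\Lambda(x_2)\cdots\Lambda(x_n)$ for all $x_1,\dots,x_n\in G$. It is irreducible if $m\ge 1$ and no subspace of $\mathbb C^m$ other than $0$ and $\mathbb C^m$ is invariant under all $\Lambda(x)$, $x\in G$. Two representations $\Lambda,\Gamma$ are equivalent if they have the same degree and $\Gamma(x)=P\Lambda(x)P^{-1}$ for all $x\in G$, for some fixed invertible matrix $P$. Theorem. The irreducible representations of $(G,f)$ fall into finitely many equivalence classes. If $\Lambda_1,\dots,\Lambda_k$ is a complete list of pairwise non-equivalent irreducible representations of $(G,f)$, with degrees $d_1,\dots,d_k$, then every $d_i$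 divides $(n-1)|G|$, and $$\sum_{i=1}^k d_i^2=(n-1)|G|.$$ -/

import Mathlib

/-- The result of applying the `n`-ary operation `f` twice to `x 0, …, x (2 n - 2)`, the inner
application starting at position `i` (positions are counted from `0`):
`f (x 0, …, x (i - 1), f (x i, …, x (i + n - 1)), x (i + n), …, x (2 n - 2))`.
The values of the sequence `x` from position `2 n - 1` on play no role. -/
def naryNested {G : Type*} {n : ℕ} (f : (Fin n → G) → G) (i : Fin n) (x : ℕ → G) : G :=
  f fun k : Fin n =>
    if (k : ℕ) < (i : ℕ) then x k
    else if (k : ℕ) = (i : ℕ) then f fun l : Fin n => x ((i : ℕ) + (l : ℕ))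
    else x ((k : ℕ) + n - 1)

/-- `(G, f)` is an `n`-ary (polyadic) group: `n ≥ 2`, `G` is non-empty, `f` is associative, and
`f (x 0, …, x (i - 1), z, x (i + 1), …, x (n - 1)) = y` has a unique solution `z` for every
place `i` (the entry `x i` itself is overwritten by `z`). -/
structure IsNaryGroup {G : Type*} {n : ℕ} (f : (Fin n → G) → G) : Prop where
  two_le : 2 ≤ n
  nonempty : Nonempty G
  assoc : ∀ (i j : Fin n) (x : ℕ → G), naryNested f i x = naryNested f j x
  existsUnique_solution : ∀ (i : Fin n) (x : Fin n → G) (y : G),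
    ∃! z : G, f (Function.update x i z) = y

/-- A (complex, matrix) representation of degree `m` of `(G, f)`: a map `Λ : G → GL_m(ℂ)` with
`Λ (f (x 0, …, x (n - 1))) = Λ (x 0) * ⋯ * Λ (x (n - 1))`, the product taken in this order. -/
structure NaryRep {G : Type*} {n : ℕ} (f : (Fin n → G) → G) (m : ℕ) where
  toFun : G → GL (Fin m) ℂ
  map_op : ∀ x : Fin n → G, toFun (f x) = (List.ofFn fun i => toFun (x i)).prod

namespace NaryRep

/-- The action of the matrix of `x` on column vectors. -/
def act {G : Type*} {n : ℕ} {f : (Fin n → G) → G} {m : ℕ} (Λ : NaryRep f m) (x : G)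
    (v : Fin m → ℂ) : Fin m → ℂ :=
  Matrix.mulVec (Λ.toFun x : Matrix (Fin m) (Fin m) ℂ) v

/-- A representation is irreducible if its space is non-zero and the only subspaces that are
invariant under all the matrices are the zero space and the whole space. -/
def IsIrreducible {G : Type*} {n : ℕ} {f : (Fin n → G) → G} {m : ℕ} (Λ : NaryRep f m) : Prop :=
  0 < m ∧ ∀ W : Submodule ℂ (Fin m → ℂ),
    (∀ x : G, ∀ v ∈ W, Λ.act x v ∈ W) → W = ⊥ ∨ W = ⊤

/-- Two representations are equivalent if an invertible linear map intertwines them. -/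
def Equivalent {G : Type*} {n : ℕ} {f : (Fin n → G) → G} {m m' : ℕ}
    (Λ : NaryRep f m) (Γ : NaryRep f m') : Prop :=
  ∃ T : (Fin m → ℂ) ≃ₗ[ℂ] (Fin m' → ℂ), ∀ (x : G) (v : Fin m → ℂ),
    T (Λ.act x v) = Γ.act x (T v)

end NaryRep

/-- `Λ 0, …, Λ (k - 1)`, of degrees `d 0, …, d (k - 1)`, are all the irreducible representations
of `(G, f)` up to equivalence, each equivalence class being listed exactly once. -/
structure IsCompleteIrreducibleList {G : Type*} {n : ℕ} (f : (Fin n → G) → G) {k : ℕ}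
    (d : Fin k → ℕ) (Λ : ∀ i : Fin k, NaryRep f (d i)) : Prop where
  irreducible : ∀ i, (Λ i).IsIrreducible
  not_equivalent : ∀ i j, i ≠ j → ¬ (Λ i).Equivalent (Λ j)
  complete : ∀ (m : ℕ) (Γ : NaryRep f m), Γ.IsIrreducible → ∃ i, Γ.Equivalent (Λ i)

-- Put `N = n - 1`. As in Post's coset theorem, `G` generates a finite group `H` of order `N * |G|`
-- in which `f` is the product of `n` elements. Every representation of `(G, f)` extends to `H`, and
-- every representation of `H` restricts to `G`; as `G` generates `H`, invariant subspaces and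
-- intertwining maps are the same on both sides. The theorem thus reduces to two classical facts
-- about `H`: Wedderburn's decomposition of `ℂ[H]`, whose dimension is the sum of the squares of the
-- degrees, and the divisibility of `|H|` by the degree of an irreducible representation.
--
-- `H` is the quotient of the free monoid on `G` that identifies words of the same length modulo `N`
-- with equal long products in all contexts. The crucial point is `longOp_congr`: agreement in a
-- single context suffices. Hence a class amounts to its degree and one long product, and all pairs
-- occur (`coverInvariant_bijective`), which gives the order. Rebracketing and cancellation make `H`
-- left cancellative, so, being finite, it is a group.

universe u

/-! ### Associativity and cancellation for iterated operations. -/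

namespace NaryGroup

variable {G : Type*} {N : ℕ}

/-- The value of `f` on the first `N + 1` entries of a list, padded with `c` if it is shorter. -/
def listOp (f : (Fin (N + 1) → G) → G) (c : G) (l : List G) : G :=
  f fun k => l.getD k c

/-- The result of applying `f` repeatedly, `k` times, at the beginning of a list, followed by
taking the first entry. -/
def iterOp (f : (Fin (N + 1) → G) → G) (c : G) : ℕ → List G → G
  | 0, l => l.headD c
  | k + 1, l => iterOp f c k (listOp f c l :: l.drop (N + 1))

/-- The long product of a list whose length is congruent to `1` modulo `N`. -/
def longOp (f : (Fin (N + 1) → G) → G) (c : G) (l : List G) : G :=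
  iterOp f c ((l.length - 1) / N) l

theorem listOp_append (f : (Fin (N + 1) → G) → G) (c : G) (u v : List G)
    (hu : N + 1 ≤ u.length) : listOp f c (u ++ v) = listOp f c u := by
  unfold listOp
  congr 1
  funext k
  exact List.getD_append _ _ _ _ (by omega)

section

variable {f : (Fin (N + 1) → G) → G} (hf : IsNaryGroup f) (c : G)

-- This is the associativity axiom for the places `|u|` and `0`, read on the sequence `u ++ v ++ w`
-- padded with `c`. Both sides see the same padding, so `w` may have any length.
include hf in
theorem listOp_assoc (u v w : List G) (hu : u.length ≤ N) (hv : v.length = N + 1) :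
    listOp f c (u ++ listOp f c v :: w) =
      listOp f c (listOp f c (u ++ v ++ w) :: (u ++ v ++ w).drop (N + 1)) := by
  have key := hf.assoc ⟨u.length, by omega⟩ 0 (fun k => (u ++ v ++ w).getD k c)
  have h1 : naryNested f ⟨u.length, by omega⟩ (fun k => (u ++ v ++ w).getD k c) =
      listOp f c (u ++ listOp f c v :: w) := by
    unfold naryNested
    conv_rhs => unfold listOp
    congr 1
    funext k
    simp only
    split_ifs with ha hb
    · rw [List.append_assoc, List.getD_append _ _ _ _ ha, List.getD_append _ _ _ _ ha]
    · rw [hb, List.getD_append_right _ _ _ _ le_rfl]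
      simp only [Nat.sub_self, List.getD_cons_zero]
      show _ = f fun k => v.getD k c
      congr 1
      funext l
      rw [List.append_assoc, List.getD_append_right _ _ _ _ (by omega),
        List.getD_append _ _ _ _ (by omega)]
      congr 1
      omega
    · rw [List.getD_append_right _ _ _ _ (by simp; omega),
        List.getD_append_right _ _ _ _ (by omega)]
      obtain ⟨j, hj⟩ : ∃ j, (k : ℕ) = u.length + (j + 1) := ⟨k - u.length - 1, by omega⟩
      rw [hj]
      simp only [Nat.add_sub_cancel_left, List.getD_cons_succ, List.length_append]
      congr 1
      omega
  have h2 : naryNested f 0 (fun k => (u ++ v ++ w).getD k c) =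
      listOp f c (listOp f c (u ++ v ++ w) :: (u ++ v ++ w).drop (N + 1)) := by
    generalize u ++ v ++ w = l
    unfold naryNested
    conv_rhs => unfold listOp
    congr 1
    funext k
    refine Fin.cases ?_ (fun j => ?_) k
    · simp
    · simp [List.getD_eq_getElem?_getD, add_comm, add_left_comm]
  rw [← h1, ← h2, key]

include hf in
theorem listOp_injective (u v : List G) (hu : u.length ≤ N) :
    Function.Injective fun z => listOp f c (u ++ z :: v) := by
  have key : ∀ z, listOp f c (u ++ z :: v) =
      f (Function.update (fun k : Fin (N + 1) => (u ++ c :: v).getD k c)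
        ⟨u.length, by omega⟩ z) := by
    intro z
    unfold listOp
    congr 1
    funext k
    rw [Function.update_apply]
    split_ifs with h
    · subst h
      rw [List.getD_append_right _ _ _ _ le_rfl]
      simp
    · rcases lt_or_ge (k : ℕ) u.length with h' | h'
      · rw [List.getD_append _ _ _ _ h', List.getD_append _ _ _ _ h']
      · rw [List.getD_append_right _ _ _ _ h', List.getD_append_right _ _ _ _ h']
        obtain ⟨j, hj⟩ : ∃ j, (k : ℕ) - u.length = j + 1 :=
          ⟨k - u.length - 1, by have : (k : ℕ) ≠ u.length := fun e => h (Fin.ext e)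
                                omega⟩
        simp [hj]
  intro z z' h
  simp only [key] at h
  obtain ⟨y, -, hy⟩ := hf.existsUnique_solution ⟨u.length, by omega⟩
    (fun k : Fin (N + 1) => (u ++ c :: v).getD k c)
    (f (Function.update (fun k : Fin (N + 1) => (u ++ c :: v).getD k c)
        ⟨u.length, by omega⟩ z'))
  rw [hy z h, hy z' rfl]

-- An inner block may be evaluated first. If the initial block lies inside `u`, contract it on both
-- sides and induct; otherwise it meets `v` or ends just before the end of `v`, and `listOp_assoc`
-- moves the inner operation to the front.
include hf in
theorem iterOp_succ (k : ℕ) (u v w : List G) (hv : v.length = N + 1)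
    (h : u.length + w.length = k * N) :
    iterOp f c (k + 1) (u ++ v ++ w) = iterOp f c k (u ++ listOp f c v :: w) := by
  induction k generalizing u with
  | zero =>
    obtain ⟨rfl, rfl⟩ : u = [] ∧ w = [] := by
      constructor <;> apply List.eq_nil_of_length_eq_zero <;> omega
    simp [iterOp]
  | succ k ih =>
    rw [add_mul, one_mul] at h
    rcases le_or_gt (N + 1) u.length with hu | hu
    · have := ih (listOp f c u :: u.drop (N + 1)) (by simp; omega)
      have e : ∀ y i, iterOp f c (i + 1) (u ++ y) =
          iterOp f c i (listOp f c u :: (u.drop (N + 1) ++ y)) := by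
        intro y i
        rw [iterOp, listOp_append f c u _ hu, List.drop_append_of_le_length hu]
      rw [List.append_assoc, e, e]
      simpa using this
    · rw [iterOp, iterOp, ← listOp_assoc hf c u v w (by omega) hv, iterOp]
      congr 2
      have e1 : (u ++ v ++ w).drop (N + 1 + N) = w.drop (N - u.length) := by
        rw [List.drop_append, List.drop_eq_nil_of_le (by simp; omega), List.nil_append]
        congr 1
        simp
        omega
      have e2 : (u ++ listOp f c v :: w).drop (N + 1) = w.drop (N - u.length) := by
        rw [List.drop_append, List.drop_eq_nil_of_le (by omega), List.nil_append,
          show N + 1 - u.length = (N - u.length) + 1 by omega, List.drop_succ_cons]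
      rw [List.drop_succ_cons, List.drop_drop, e1, e2]

include hf in
theorem iterOp_assoc (j k : ℕ) (u p w : List G) (hp : p.length = j * N + 1)
    (h : u.length + w.length = k * N) :
    iterOp f c (k + j) (u ++ p ++ w) = iterOp f c k (u ++ iterOp f c j p :: w) := by
  induction j generalizing p with
  | zero =>
    obtain ⟨y, rfl⟩ := List.length_eq_one_iff.1 (by simpa using hp)
    simp [iterOp]
  | succ j ih =>
    rw [add_mul, one_mul] at hp
    rw [iterOp, ← ih _ (by simp; omega)]
    have e : p.take (N + 1) ++ p.drop (N + 1) = p := List.take_append_drop _ _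
    have ht : (p.take (N + 1)).length = N + 1 := by simp; omega
    have hl : listOp f c p = listOp f c (p.take (N + 1)) := by
      conv_lhs => rw [← e]
      exact listOp_append f c _ _ ht.ge
    have := iterOp_succ hf c (k + j) u (p.take (N + 1)) (p.drop (N + 1) ++ w) ht
      (by rw [add_mul]; simp; omega)
    rw [← List.append_assoc, List.append_assoc u, e] at this
    rw [hl, ← add_assoc, this]
    simp

include hf in
theorem iterOp_injective (k : ℕ) (u w : List G) (h : u.length + w.length = k * N) :
    Function.Injective fun z => iterOp f c k (u ++ z :: w) := by
  induction k generalizing u w with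
  | zero =>
    obtain ⟨rfl, rfl⟩ : u = [] ∧ w = [] := by
      constructor <;> apply List.eq_nil_of_length_eq_zero <;> omega
    intro z z' h
    simpa [iterOp] using h
  | succ k ih =>
    rw [add_mul, one_mul] at h
    intro z z' hz
    rcases le_or_gt (N + 1) u.length with hu | hu
    · simp only [iterOp, listOp_append f c u _ hu, List.drop_append_of_le_length hu] at hz
      exact ih (listOp f c u :: u.drop (N + 1)) w (by simp; omega) (by simpa using hz)
    · have e : ∀ y, (u ++ y :: w).drop (N + 1) = w.drop (N - u.length) := by
        intro y
        have e3 : u.drop (N + 1) = [] := List.drop_eq_nil_of_le (by omega)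
        rw [List.drop_append, e3, show N + 1 - u.length = (N - u.length) + 1 by omega]
        simp
      simp only [iterOp, e] at hz
      exact listOp_injective hf c u w (by omega)
        (ih [] (w.drop (N - u.length)) (by simp; omega) hz)

end

/-! ### Degrees of words, and independence of long products from the context. -/

/-- The length of a list modulo `N`. -/
def deg (N : ℕ) (l : List G) : ZMod N := l.length

@[simp] theorem deg_nil : deg N ([] : List G) = 0 := by simp [deg]
@[simp] theorem deg_append (u v : List G) : deg N (u ++ v) = deg N u + deg N v := by simp [deg]
@[simp] theorem deg_cons (x : G) (v : List G) : deg N (x :: v) = deg N v + 1 := by simp [deg]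

theorem exists_deg_eq [NeZero N] (c : G) (r : ZMod N) : ∃ s : List G, deg N s = r :=
  ⟨List.replicate r.val c, by simp [deg]⟩

theorem exists_length_eq_of_deg_eq_zero {l : List G} (h : deg N l = 0) :
    ∃ k, l.length = k * N := by
  obtain ⟨k, hk⟩ := (ZMod.natCast_eq_zero_iff _ _).1 h
  exact ⟨k, by rw [hk, mul_comm]⟩

/-- Non-emptiness cannot be dropped: for `N = 1`, the case of ordinary groups, `ZMod 1` is trivial
and the empty word also has degree one. -/
theorem exists_length_eq_of_deg_eq_one {l : List G} (hl : l ≠ []) (h : deg N l = 1) :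
    ∃ k, l.length = k * N + 1 := by
  obtain ⟨a, l, rfl⟩ := List.exists_cons_of_ne_nil hl
  obtain ⟨k, hk⟩ := exists_length_eq_of_deg_eq_zero (N := N) (l := l) (by simpa using h)
  exact ⟨k, by simp [hk]⟩

section

variable [NeZero N] {f : (Fin (N + 1) → G) → G} (hf : IsNaryGroup f) (c : G)

theorem longOp_eq_iterOp {k : ℕ} {l : List G} (h : l.length = k * N + 1) :
    longOp f c l = iterOp f c k l := by
  rw [longOp, h, Nat.add_sub_cancel, Nat.mul_div_cancel _ (NeZero.pos N)]

include hf in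
theorem longOp_assoc (u p w : List G) (hp0 : p ≠ []) (hp : deg N p = 1)
    (h : deg N u + deg N w = 0) :
    longOp f c (u ++ p ++ w) = longOp f c (u ++ longOp f c p :: w) := by
  obtain ⟨j, hj⟩ := exists_length_eq_of_deg_eq_one hp0 hp
  obtain ⟨k, hk⟩ := exists_length_eq_of_deg_eq_zero (N := N) (l := u ++ w) (by simpa using h)
  rw [List.length_append] at hk
  rw [longOp_eq_iterOp c hj, longOp_eq_iterOp c (k := k + j) (by simp [add_mul]; omega),
    longOp_eq_iterOp c (k := k) (by simp; omega), iterOp_assoc hf c j k u p w hj hk]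

include hf in
theorem longOp_injective (u w : List G) (h : deg N u + deg N w = 0) :
    Function.Injective fun z => longOp f c (u ++ z :: w) := by
  obtain ⟨k, hk⟩ := exists_length_eq_of_deg_eq_zero (N := N) (l := u ++ w) (by simpa using h)
  rw [List.length_append] at hk
  intro z z' hz
  simp only at hz
  rw [longOp_eq_iterOp c (k := k) (by simp; omega),
    longOp_eq_iterOp c (k := k) (by simp; omega)] at hz
  exact iterOp_injective hf c k u w hk hz

theorem longOp_ofFn (x : Fin (N + 1) → G) : longOp f c (List.ofFn x) = f x := by
  rw [longOp_eq_iterOp c (k := 1) (by simp)]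
  show f _ = f x
  congr 1
  funext k
  rw [List.getD_eq_getElem _ _ (by rw [List.length_ofFn]; exact k.2), List.getElem_ofFn]

include hf in
/-- Two long products that agree in one context on the right agree after changing the word on
their left to another one of the same degree. -/
theorem longOp_congr_left (x w p p' : List G) (hx : deg N x = deg N w)
    (hp : deg N x + deg N p = 0) (hp' : deg N p = deg N p')
    (h : longOp f c (x ++ p ++ [c]) = longOp f c (x ++ p' ++ [c])) :
    longOp f c (w ++ p ++ [c]) = longOp f c (w ++ p' ++ [c]) := by
  -- The word `x p c s t` can be bracketed as `[x p c] s t` or as `x [p c s] t`. Cancelling `x` and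
  -- `t` gives `[p c s] = [p' c s]`; this is put behind `w`, rebracketed, and `s t` is cancelled.
  obtain ⟨s, hs⟩ := exists_deg_eq c (-deg N p)
  obtain ⟨t, ht⟩ := exists_deg_eq c (-deg N x)
  have hst : deg N s + deg N t = 0 := by rw [hs, ht]; linear_combination -hp
  have e1 : ∀ y q, deg N y = deg N x → deg N q = deg N p →
      longOp f c (y ++ (q ++ [c] ++ s) ++ t) =
        longOp f c ([] ++ longOp f c (y ++ q ++ [c]) :: (s ++ t)) := by
    intro y q hy hq
    rw [← longOp_assoc hf c [] _ (s ++ t) (by simp)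
      (by simp only [deg_append, deg_cons, deg_nil, hy, hq]; linear_combination hp)
      (by simpa using hst)]
    simp
  have e2 : ∀ y q, deg N y = deg N x → deg N q = deg N p →
      longOp f c (y ++ (q ++ [c] ++ s) ++ t) =
        longOp f c (y ++ longOp f c (q ++ [c] ++ s) :: t) := by
    intro y q hy hq
    exact longOp_assoc hf c y _ t (by simp) (by simp [hq, hs]) (by simp [hy, ht])
  have e3 := e1 x p rfl rfl
  rw [h, ← e1 x p' rfl hp'.symm, e2 x p rfl rfl, e2 x p' rfl hp'.symm] at e3
  have e4 := longOp_injective hf c x t (by simp [ht]) e3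
  have e5 := e2 w p hx.symm rfl
  rw [e4, ← e2 w p' hx.symm hp'.symm, e1 w p hx.symm rfl, e1 w p' hx.symm hp'.symm] at e5
  exact longOp_injective hf c [] (s ++ t) (by simpa using hst) e5

include hf in
theorem longOp_surjective [Finite G] (u w : List G) (h : deg N u + deg N w = 0) :
    Function.Surjective fun z => longOp f c (u ++ z :: w) :=
  Finite.injective_iff_surjective.1 (longOp_injective hf c u w h)

include hf in
/-- Two words whose long products agree in one context on the right agree in every context. -/
theorem longOp_congr [Finite G] (w w' v : List G) (hw : deg N w = deg N w')
    (hv : deg N w + deg N v = 0)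
    (h : longOp f c (w ++ v ++ [c]) = longOp f c (w' ++ v ++ [c]))
    (u v' : List G) (hu : deg N u + deg N w + deg N v' = 0) :
    longOp f c (u ++ w ++ v' ++ [c]) = longOp f c (u ++ w' ++ v' ++ [c]) := by
  obtain ⟨s, hs⟩ := exists_deg_eq c (-deg N w - deg N v' - 1)
  obtain ⟨t, ht⟩ := exists_deg_eq c (-deg N u)
  -- first change the context on the right to `v' ++ [c] ++ s`
  obtain ⟨q, hq⟩ := exists_deg_eq (N := N) c (-2)
  -- The letter `z` is chosen so that `v c z q` and `v' c s` agree behind `w`, hence behind `w'` by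
  -- `longOp_congr_left`. Degree `-2` for `q` makes `c z q` of degree zero. As `[w v c] = [w' v c]`,
  -- the words `w` and `w'` then agree in front of `v' c s`.
  obtain ⟨z, hz⟩ := longOp_surjective hf c (w ++ v ++ [c]) (q ++ [c])
    (by simp only [deg_append, deg_cons, deg_nil, hq]; linear_combination hv)
    (longOp f c (w ++ (v' ++ [c] ++ s) ++ [c]))
  have hdz : deg N (v ++ c :: z :: q) = deg N (v' ++ [c] ++ s) := by
    simp only [deg_append, deg_cons, deg_nil, hq, hs]; linear_combination hv
  have h1 : longOp f c (w' ++ (v ++ c :: z :: q) ++ [c]) =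
      longOp f c (w' ++ (v' ++ [c] ++ s) ++ [c]) := by
    refine longOp_congr_left hf c w w' _ _ hw ?_ hdz ?_
    · simp only [deg_append, deg_cons, hq]; linear_combination hv
    · simpa using hz
  have h2 : ∀ y, deg N y = deg N w → longOp f c (y ++ (v ++ c :: z :: q) ++ [c]) =
      longOp f c ([] ++ longOp f c (y ++ v ++ [c]) :: (z :: q ++ [c])) := by
    intro y hy
    rw [← longOp_assoc hf c [] _ _ (by simp)
      (by simp only [deg_append, deg_cons, deg_nil, hy]; linear_combination hv)
      (by simp only [deg_append, deg_cons, deg_nil, hq]; ring)]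
    simp
  have h3 : longOp f c (w ++ (v' ++ [c] ++ s) ++ [c]) =
      longOp f c (w' ++ (v' ++ [c] ++ s) ++ [c]) := by
    rw [← h1, h2 w' hw.symm, ← h, ← h2 w rfl]
    simpa using hz.symm
  -- To insert `u` on the left, compare the bracketings `[u y v' c] s c t` and `u [y v' c s c] t`,
  -- then cancel `s c t`.
  have hst : deg N (s ++ c :: t) = 0 := by
    simp only [deg_append, deg_cons, hs, ht]; linear_combination -hu
  have h4 : ∀ y, deg N y = deg N w →
      longOp f c ([] ++ longOp f c (u ++ y ++ v' ++ [c]) :: (s ++ c :: t)) =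
        longOp f c (u ++ longOp f c (y ++ (v' ++ [c] ++ s) ++ [c]) :: t) := by
    intro y hy
    rw [← longOp_assoc hf c [] _ _ (by simp)
      (by simp only [deg_append, deg_cons, deg_nil, hy]; linear_combination hu)
      (by simpa using hst), ← longOp_assoc hf c u _ t (by simp)
      (by simp only [deg_append, deg_cons, deg_nil, hy, hs]; ring) (by simp [ht])]
    simp
  have h5 := h4 w rfl
  rw [h3, ← h4 w' hw.symm] at h5
  exact longOp_injective hf c [] _ (by simpa using hst) h5

end

/-! ### The covering group. -/

section

variable [NeZero N] {f : (Fin (N + 1) → G) → G} (hf : IsNaryGroup f) (c : G)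

/-- Two words are equivalent if they have the same degree and the same long products in all
contexts. -/
def coverCon (f : (Fin (N + 1) → G) → G) (c : G) : Con (FreeMonoid G) where
  -- The final `c` turns a word of degree zero, possibly empty, into a non-empty word of degree one,
  -- whose long product makes sense.
  r w w' := deg N w.toList = deg N w'.toList ∧ ∀ u v : List G,
    deg N u + deg N w.toList + deg N v = 0 →
      longOp f c (u ++ w.toList ++ v ++ [c]) = longOp f c (u ++ w'.toList ++ v ++ [c])
  iseqv :=
    { refl := fun _ => ⟨rfl, fun _ _ _ => rfl⟩
      symm := fun h => ⟨h.1.symm, fun u v e => (h.2 u v (by rw [h.1]; exact e)).symm⟩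
      trans := fun h h' => ⟨h.1.trans h'.1, fun u v e =>
        (h.2 u v e).trans (h'.2 u v (by rw [← h.1]; exact e))⟩ }
  mul' := by
    intro a b x y h h'
    simp only [FreeMonoid.toList_mul, deg_append]
    refine ⟨by rw [h.1, h'.1], fun u v e => ?_⟩
    have h1 := h.2 u (x.toList ++ v) (by rw [deg_append]; linear_combination e)
    have h2 := h'.2 (u ++ b.toList) v (by rw [deg_append, ← h.1]; linear_combination e)
    simp only [List.append_assoc] at h1 h2 ⊢
    rw [h1, h2]

omit [NeZero N] in
theorem coverCon_iff {w w' : FreeMonoid G} : coverCon f c w w' ↔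
    deg N w.toList = deg N w'.toList ∧ ∀ u v : List G,
      deg N u + deg N w.toList + deg N v = 0 →
        longOp f c (u ++ w.toList ++ v ++ [c]) = longOp f c (u ++ w'.toList ++ v ++ [c]) :=
  Iff.rfl

/-- The universal cover of an `n`-ary group, as a quotient of the free monoid. -/
abbrev Cover (f : (Fin (N + 1) → G) → G) (c : G) := (coverCon f c).Quotient

/-- A word that completes words of degree `r` to words of degree zero. -/
noncomputable def complement (N : ℕ) [NeZero N] (c : G) (r : ZMod N) : List G :=
  (exists_deg_eq c (-r)).choose

@[simp] theorem deg_complement (r : ZMod N) : deg N (complement N c r) = -r :=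
  (exists_deg_eq c (-r)).choose_spec

include hf in
theorem coverCon_of_longOp_eq [Finite G] {w w' : FreeMonoid G} (v : List G)
    (hw : deg N w.toList = deg N w'.toList) (hv : deg N w.toList + deg N v = 0)
    (h : longOp f c (w.toList ++ v ++ [c]) = longOp f c (w'.toList ++ v ++ [c])) :
    coverCon f c w w' :=
  ⟨hw, longOp_congr hf c _ _ v hw hv h⟩

/-- The degree of an element of the cover, together with its long product with a fixed word of
complementary degree. -/
noncomputable def coverInvariant (f : (Fin (N + 1) → G) → G) (c : G) :
    Cover f c → ZMod N × G :=
  Quotient.lift (fun w : FreeMonoid G => (deg N w.toList,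
      longOp f c (w.toList ++ complement N c (deg N w.toList) ++ [c]))) <| by
    intro w w' h
    have h' : coverCon f c w w' := h
    have := h'.2 [] (complement N c (deg N w.toList)) (by simp)
    simp only [List.nil_append] at this
    rw [Prod.mk.injEq]
    exact ⟨h'.1, by rw [this, h'.1]⟩

theorem coverInvariant_mk (w : FreeMonoid G) :
    coverInvariant f c (w : Cover f c) = (deg N w.toList,
      longOp f c (w.toList ++ complement N c (deg N w.toList) ++ [c])) := rfl

-- Injectivity is the one-context criterion. For surjectivity, fix a word `t` of degree `r - 1` and
-- solve for a letter `z` in front of it.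
include hf in
theorem coverInvariant_bijective [Finite G] : Function.Bijective (coverInvariant f c) := by
  constructor
  · intro a b
    induction a using Con.induction_on with | _ w
    induction b using Con.induction_on with | _ w'
    intro h
    rw [coverInvariant_mk, coverInvariant_mk, Prod.mk.injEq] at h
    rw [Con.eq]
    exact coverCon_of_longOp_eq hf c (complement N c (deg N w.toList)) h.1 (by simp)
      (by rw [h.2, h.1])
  · rintro ⟨r, a⟩
    obtain ⟨t, ht⟩ := exists_deg_eq c (r - 1)
    obtain ⟨z, hz⟩ := longOp_surjective hf c [] (t ++ complement N c r ++ [c]) (by simp [ht]) a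
    have hd : deg N (z :: t) = r := by simp [ht]
    refine ⟨((FreeMonoid.ofList (z :: t) : FreeMonoid G) : Cover f c), ?_⟩
    rw [coverInvariant_mk, FreeMonoid.toList_ofList, hd]
    simpa using hz

include hf in
theorem card_cover [Finite G] : Nat.card (Cover f c) = N * Nat.card G := by
  rw [Nat.card_congr (Equiv.ofBijective _ (coverInvariant_bijective hf c)), Nat.card_prod,
    Nat.card_zmod]

include hf in
theorem finite_cover [Finite G] : Finite (Cover f c) :=
  Finite.of_injective _ (coverInvariant_bijective hf c).injective

-- In a product beginning with `x`, the part `y v c` behind `x` can be bracketed into one letter,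
-- which is determined by cancellation; one context then suffices.
include hf in
theorem cover_mul_left_cancel [Finite G] (a b b' : Cover f c) (h : a * b = a * b') : b = b' := by
  induction a using Con.induction_on with | _ x
  induction b using Con.induction_on with | _ w
  induction b' using Con.induction_on with | _ w'
  rw [← Con.coe_mul, ← Con.coe_mul, Con.eq, coverCon_iff] at h
  simp only [FreeMonoid.toList_mul, deg_append, add_right_inj] at h
  obtain ⟨hd, h⟩ := h
  rw [Con.eq]
  refine coverCon_of_longOp_eq hf c (complement N c (deg N w.toList)) hd (by simp) ?_
  have e : ∀ y, deg N y = deg N w.toList →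
      longOp f c ([] ++ (x.toList ++ y) ++ (complement N c (deg N w.toList) ++ [c] ++
        complement N c (deg N x.toList + 1)) ++ [c]) =
      longOp f c (x.toList ++ longOp f c (y ++ complement N c (deg N w.toList) ++ [c]) ::
        (complement N c (deg N x.toList + 1) ++ [c])) := by
    intro y hy
    rw [← longOp_assoc hf c _ _ _ (by simp) (by simp [hy]) (by simp)]
    simp
  have h1 := h [] (complement N c (deg N w.toList) ++ [c] ++
    complement N c (deg N x.toList + 1)) (by simp)
  rw [e _ rfl, e _ hd.symm] at h1
  exact longOp_injective hf c _ _ (by simp) h1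

/-- The cover of a finite `n`-ary group is a group, being a finite cancellative monoid. -/
@[reducible] noncomputable def coverGroup [Finite G] (hf : IsNaryGroup f) (c : G) :
    Group (Cover f c) :=
  haveI := finite_cover hf c
  letI : LeftCancelMonoid (Cover f c) :=
    { (inferInstance : Monoid (Cover f c)) with
      mul_left_cancel := fun a b b' h => cover_mul_left_cancel hf c a b b' h }
  LeftCancelMonoid.groupOfFinite

include hf in
theorem coverCon_op (x : Fin (N + 1) → G) :
    coverCon f c (FreeMonoid.of (f x)) (FreeMonoid.ofList (List.ofFn x)) := by
  rw [coverCon_iff]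
  simp only [FreeMonoid.toList_of, FreeMonoid.toList_ofList]
  have hd : deg N (List.ofFn x) = 1 := by
    rw [deg, List.length_ofFn]
    simp
  refine ⟨by rw [hd]; simp, fun u v h => ?_⟩
  have := longOp_assoc hf c u (List.ofFn x) (v ++ [c]) (by simp) hd
    (by simpa [add_assoc, add_comm, add_left_comm] using h)
  rw [longOp_ofFn] at this
  simp only [List.append_assoc, List.cons_append, List.nil_append] at this ⊢
  exact this.symm

theorem map_longOp {K : Type*} [Monoid K] (g : G → K)
    (hg : ∀ x : Fin (N + 1) → G, g (f x) = (List.ofFn fun i => g (x i)).prod)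
    (l : List G) (hl : l ≠ []) (hd : deg N l = 1) : g (longOp f c l) = (l.map g).prod := by
  have key : ∀ (k : ℕ) (l : List G), l.length = k * N + 1 →
      g (iterOp f c k l) = (l.map g).prod := by
    intro k
    induction k with
    | zero =>
      intro l hl
      obtain ⟨y, rfl⟩ := List.length_eq_one_iff.1 (by simpa using hl)
      simp [iterOp]
    | succ k ih =>
      intro l hl
      rw [add_mul, one_mul] at hl
      rw [iterOp, ih _ (by simp; omega), listOp, List.map_cons, List.prod_cons, hg]
      have e : (List.ofFn fun i : Fin (N + 1) => g (l.getD i c)) = (l.take (N + 1)).map g := by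
        apply List.ext_getElem
        · simp; omega
        · intro i h1 h2
          simp only [List.length_ofFn] at h1
          rw [List.getElem_ofFn, List.getElem_map, List.getElem_take,
            List.getD_eq_getElem _ _ (show i < l.length by omega)]
      rw [e, ← List.prod_append, ← List.map_append, List.take_append_drop]
  obtain ⟨k, hk⟩ := exists_length_eq_of_deg_eq_one hl hd
  rw [longOp_eq_iterOp c hk, key k l hk]

/-- Every map to a group that is multiplicative for `f` factors through the cover. -/
noncomputable def coverLift {K : Type*} [Group K] (f : (Fin (N + 1) → G) → G) (c : G) (g : G → K)
    (hg : ∀ x : Fin (N + 1) → G, g (f x) = (List.ofFn fun i => g (x i)).prod) :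
    Cover f c →* K :=
  Con.lift (coverCon f c) (FreeMonoid.lift g) <| by
    intro w w' h
    obtain ⟨hd, h⟩ := h
    -- Long products become products in `K`, where the common right factor coming from the
    -- complement and `c` cancels.
    have := congrArg g (h [] (complement N c (deg N w.toList)) (by simp))
    rw [map_longOp c g hg _ (by simp) (by simp),
      map_longOp c g hg _ (by simp) (by simp [hd])] at this
    rw [Con.ker_apply, FreeMonoid.lift_apply, FreeMonoid.lift_apply]
    simpa using this

end

/-- Post's coset theorem: a finite `n`-ary group generates a finite group of order `(n - 1) * |G|`
in which its operation is the product of `n` elements, and through which its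
representations factor. -/
theorem exists_covering_group {G : Type u} [Finite G] {n : ℕ} (f : (Fin n → G) → G)
    (hf : IsNaryGroup f) :
    ∃ (H : Type u) (_ : Group H) (_ : Finite H) (ι : G → H),
      Nat.card H = (n - 1) * Nat.card G ∧ Submonoid.closure (Set.range ι) = ⊤ ∧
      (∀ x : Fin n → G, ι (f x) = (List.ofFn fun i => ι (x i)).prod) ∧
      ∀ (m : ℕ) (Λ : NaryRep f m), ∃ ρ : H →* GL (Fin m) ℂ, ∀ x, ρ (ι x) = Λ.toFun x := by
  obtain ⟨N, rfl⟩ : ∃ N, n = N + 1 := ⟨n - 1, by have := hf.two_le; omega⟩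
  have : NeZero N := ⟨by have := hf.two_le; omega⟩
  obtain ⟨c⟩ := hf.nonempty
  refine ⟨Cover f c, coverGroup hf c, finite_cover hf c,
    fun x => ((FreeMonoid.of x : FreeMonoid G) : Cover f c), card_cover hf c, ?_, ?_, ?_⟩
  · rw [eq_top_iff]
    intro a _
    induction a using Con.induction_on with | _ w
    induction w using FreeMonoid.inductionOn' with
    | one => exact Submonoid.one_mem _
    | of_mul x w ih =>
      rw [Con.coe_mul]
      exact Submonoid.mul_mem _ (Submonoid.subset_closure ⟨x, rfl⟩) (ih trivial)
  · intro x
    have h := (Con.eq _).2 (coverCon_op hf c x)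
    refine h.trans ?_
    have : (FreeMonoid.ofList (List.ofFn x)) =
        (List.ofFn fun i => FreeMonoid.of (x i)).prod := by
      have := FreeMonoid.lift_ofList (FreeMonoid.of (α := G)) (List.ofFn x)
      rw [List.map_ofFn, show FreeMonoid.lift (FreeMonoid.of (α := G)) = MonoidHom.id _ from
        FreeMonoid.hom_eq fun _ => FreeMonoid.lift_eval_of _ _] at this
      exact this
    rw [this]
    refine (map_list_prod (Con.mk' (coverCon f c)) _).trans ?_
    rw [List.map_ofFn]
    rfl
  · intro m Λ
    refine ⟨coverLift f c Λ.toFun Λ.map_op, fun x => ?_⟩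
    exact (Con.lift_coe _ _).trans (FreeMonoid.lift_eval_of _ _)

end NaryGroup

/-! ### Modules over products of matrix algebras. -/

namespace NaryGroup

open Matrix

/-- A nonzero matrix representation of a product of matrix algebras receives a nonzero
intertwining map from the standard representation of one of the factors. -/
theorem exists_ne_zero_intertwining_of_pi_matrix {k m : ℕ} (d : Fin k → ℕ) (hm : 0 < m)
    (Ψ : (∀ i, Matrix (Fin (d i)) (Fin (d i)) ℂ) →ₐ[ℂ] Matrix (Fin m) (Fin m) ℂ) :
    ∃ (i : Fin k) (T : (Fin (d i) → ℂ) →ₗ[ℂ] (Fin m → ℂ)), T ≠ 0 ∧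
      ∀ b v, T (b i *ᵥ v) = Ψ b *ᵥ T v := by
  -- The unit is the sum of the diagonal matrix units of all factors, and `Ψ 1 = 1 ≠ 0`, so `Ψ` does
  -- not kill all of them.
  obtain ⟨i, j, hij⟩ : ∃ (i : Fin k) (j : Fin (d i)),
      Ψ (Pi.single i (Matrix.single j j 1)) ≠ 0 := by
    by_contra! h
    have : Nonempty (Fin m) := ⟨⟨0, hm⟩⟩
    apply one_ne_zero (α := Matrix (Fin m) (Fin m) ℂ)
    rw [← map_one Ψ, ← Finset.univ_sum_single (1 : ∀ i, Matrix (Fin (d i)) (Fin (d i)) ℂ), map_sum]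
    refine Finset.sum_eq_zero fun i _ => ?_
    have e : (1 : Matrix (Fin (d i)) (Fin (d i)) ℂ) = ∑ j, Matrix.single j j 1 := by
      rw [Matrix.sum_single_one]
    have := map_sum Ψ (fun j => Pi.single i (Matrix.single j j 1)) Finset.univ
    rw [Pi.one_apply, e]
    have e2 : Pi.single (M := fun i => Matrix (Fin (d i)) (Fin (d i)) ℂ) i
        (∑ j : Fin (d i), Matrix.single j j 1) =
          ∑ j, Pi.single i (Matrix.single j j 1) :=
      map_sum (AddMonoidHom.single (fun i => Matrix (Fin (d i)) (Fin (d i)) ℂ) i) _ _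
    rw [e2, map_sum]
    exact Finset.sum_eq_zero fun j _ => h i j
  obtain ⟨w, hw⟩ : ∃ w, Ψ (Pi.single i (Matrix.single j j 1)) *ᵥ w ≠ 0 := by
    by_contra! h
    exact hij (Matrix.mulVec_injective (funext fun w => by simpa using h w))
  -- Column vectors are identified with the matrices supported in column `j`, a left ideal, which is
  -- then applied to `w`.
  let T : (Fin (d i) → ℂ) →ₗ[ℂ] (Fin m → ℂ) :=
    { toFun := fun v => Ψ (Pi.single i (vecMulVec v (Pi.single j 1))) *ᵥ w
      map_add' := fun v v' => by
        rw [add_vecMulVec, Pi.single_add, map_add, add_mulVec]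
      map_smul' := fun a v => by
        rw [smul_vecMulVec, Pi.single_smul, map_smul, smul_mulVec, RingHom.id_apply] }
  refine ⟨i, T, fun h => hw ?_, fun b v => ?_⟩
  · have : T (Pi.single j 1) = 0 := by rw [h]; rfl
    simpa [T, Matrix.single_eq_single_vecMulVec_single] using this
  · change Ψ _ *ᵥ w = Ψ b *ᵥ (Ψ _ *ᵥ w)
    rw [mulVec_mulVec, ← map_mul]
    congr 2
    funext l
    by_cases hl : l = i
    · subst hl
      simp [mul_vecMulVec]
    · simp [Pi.single_eq_of_ne hl]

/-- The standard representation of a matrix algebra is irreducible. -/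
theorem eq_bot_or_eq_top_of_matrix_invariant {m : ℕ} (W : Submodule ℂ (Fin m → ℂ))
    (h : ∀ (M : Matrix (Fin m) (Fin m) ℂ), ∀ v ∈ W, M *ᵥ v ∈ W) : W = ⊥ ∨ W = ⊤ := by
  by_cases hW : W = ⊥
  · exact Or.inl hW
  obtain ⟨v, hv, hv0⟩ := Submodule.exists_mem_ne_zero_of_ne_bot hW
  obtain ⟨j, hj⟩ := Function.ne_iff.1 hv0
  refine Or.inr (eq_top_iff.2 fun w _ => ?_)
  -- This rank one matrix sends `v` to `w`.
  have := h (vecMulVec w (Pi.single j (v j)⁻¹)) v hv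
  rw [vecMulVec_mulVec] at this
  have hj' : v j ≠ 0 := hj
  simpa [hj'] using this

/-! ### Degrees divide the group order. -/

section Dvd

variable {H : Type*} [Group H] [Finite H] {m : ℕ}

/-- The trace is the sum of the eigenvalues, which are roots of unity. -/
theorem isIntegral_trace_of_pow_eq_one {M : Matrix (Fin m) (Fin m) ℂ} {r : ℕ} (hr : 0 < r)
    (hM : M ^ r = 1) : IsIntegral ℤ M.trace := by
  rw [Matrix.trace_eq_sum_roots_charpoly]
  refine IsIntegral.multiset_sum fun x hx => ?_
  have hx' : Module.End.HasEigenvalue (Matrix.toLin' M) x := by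
    rw [Module.End.hasEigenvalue_iff_isRoot_charpoly, Matrix.charpoly_toLin']
    exact Polynomial.isRoot_of_mem_roots hx
  obtain ⟨v, hv⟩ := hx'.exists_hasEigenvector
  have h1 := hv.pow_apply r
  rw [← Matrix.toLin'_pow, hM, Matrix.toLin'_one, LinearMap.id_apply] at h1
  have h2 : x ^ r = 1 := by
    have : (x ^ r - 1) • v = 0 := by rw [sub_smul, one_smul, ← h1, sub_self]
    exact sub_eq_zero.1 ((smul_eq_zero.1 this).resolve_right hv.2)
  exact IsIntegral.of_pow hr (by rw [h2]; exact isIntegral_one)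

/-- The representation on column vectors of a homomorphism to a general linear group. -/
noncomputable def columnRep (ρ : H →* GL (Fin m) ℂ) : Representation ℂ H (Fin m → ℂ) :=
  ((Matrix.toLinAlgEquiv' (R := ℂ) (n := Fin m) : _ →* _).comp (Units.coeHom _)).comp ρ

omit [Finite H] in
theorem character_columnRep (ρ : H →* GL (Fin m) ℂ) (g : H) :
    (columnRep ρ).character g = (ρ g : Matrix (Fin m) (Fin m) ℂ).trace :=
  Matrix.trace_toLin'_eq _

/-- The degree of an irreducible complex representation of a finite group divides the order of
the group. -/
theorem degree_dvd_card (ρ : H →* GL (Fin m) ℂ) (hm : 0 < m)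
    (hρ : ∀ W : Submodule ℂ (Fin m → ℂ),
      (∀ g, ∀ v ∈ W, (ρ g : Matrix (Fin m) (Fin m) ℂ) *ᵥ v ∈ W) → W = ⊥ ∨ W = ⊤) :
    m ∣ Nat.card H := by
  classical
  have := Fintype.ofFinite H
  have : Nonempty (Fin m) := ⟨⟨0, hm⟩⟩
  have : Invertible (Nat.card H : ℂ) := invertibleOfNonzero (by simp [Nat.card_eq_fintype_card])
  have : (columnRep ρ).IsIrreducible :=
    { exists_pair_ne := ⟨⊥, ⊤, fun h => by
        have := congrArg Subrepresentation.toSubmodule h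
        exact bot_ne_top (α := Submodule ℂ (Fin m → ℂ)) this⟩
      eq_bot_or_eq_top := fun W => by
        rcases hρ W.toSubmodule (fun g v hv => W.apply_mem_toSubmodule g hv) with h | h
        · exact Or.inl (Subrepresentation.toSubmodule_injective h)
        · exact Or.inr (Subrepresentation.toSubmodule_injective h) }
  have horth := (columnRep ρ).char_orthonormal (columnRep ρ)
  rw [if_pos ⟨.refl _⟩] at horth
  simp only [character_columnRep] at horth
  -- the element `∑ χ(g⁻¹) g` acts as a scalar
  let χ : H → ℂ := fun g => (ρ g : Matrix (Fin m) (Fin m) ℂ).trace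
  let S : Matrix (Fin m) (Fin m) ℂ := ∑ g, χ g⁻¹ • (ρ g : Matrix (Fin m) (Fin m) ℂ)
  have hχ : ∀ g h, χ (h * g * h⁻¹) = χ g := by
    intro g h
    simp only [χ, map_mul, Units.val_mul]
    rw [Matrix.trace_mul_comm, ← mul_assoc, ← Units.val_mul, ← map_mul]
    simp
  have hScomm : ∀ h, (ρ h : Matrix (Fin m) (Fin m) ℂ) * S = S * ρ h := by
    intro h
    simp only [S, Finset.mul_sum, Finset.sum_mul, mul_smul_comm, smul_mul_assoc, ← Units.val_mul,
      ← map_mul]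
    refine Fintype.sum_equiv (MulAut.conj h).toEquiv _ _ fun g => ?_
    simp only [MulEquiv.toEquiv_eq_coe, EquivLike.coe_coe, MulAut.conj_apply]
    rw [show (h * g * h⁻¹)⁻¹ = h * g⁻¹ * h⁻¹ by group, hχ]
    congr 3
    group
  obtain ⟨a, ha⟩ : ∃ a : ℂ, S = a • 1 := by
    obtain ⟨a, ha⟩ := Module.End.exists_eigenvalue (Matrix.toLin' S)
    refine ⟨a, ?_⟩
    have hinv := hρ (Module.End.eigenspace (Matrix.toLin' S) a) (fun g v hv => by
      rw [Module.End.mem_eigenspace_iff, Matrix.toLin'_apply] at hv ⊢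
      rw [mulVec_mulVec, ← hScomm, ← mulVec_mulVec, hv, mulVec_smul])
    have htop := hinv.resolve_left ha
    refine Matrix.mulVec_injective (funext fun v => ?_)
    have hv : v ∈ Module.End.eigenspace (Matrix.toLin' S) a := htop ▸ Submodule.mem_top
    rw [Module.End.mem_eigenspace_iff, Matrix.toLin'_apply] at hv
    rw [hv, smul_mulVec, one_mulVec]
  have hcard0 : (Nat.card H : ℂ) ≠ 0 := by simp [Nat.card_eq_fintype_card]
  -- Compare traces: orthonormality gives `∑ χ(g⁻¹) χ(g) = |H|`, and `a • 1` has trace `a * m`.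
  have hS : (Nat.card H : ℂ) = a * m := by
    have h1 : S.trace = Nat.card H := by
      simp only [S, Matrix.trace_sum, Matrix.trace_smul, smul_eq_mul]
      rw [inv_mul_eq_one₀ hcard0] at horth
      rw [horth]
      exact Finset.sum_congr rfl fun g _ => mul_comm _ _
    rw [← h1, ha, Matrix.trace_smul]
    simp
  -- and it is integral
  let R := integralClosure ℤ ℂ
  have hχint : ∀ g, IsIntegral ℤ (χ g) := fun g =>
    isIntegral_trace_of_pow_eq_one (Nat.card_pos (α := H))
      (by rw [← Units.val_pow_eq_pow_val, ← map_pow, pow_card_eq_one']; simp)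
  -- The coefficients `χ(g⁻¹)` are algebraic integers, so `S` is the image of an element of `R[H]`,
  -- a finite `R`-module; hence `S` and its scalar `a = |H| / m` are integral.
  let φ : MonoidAlgebra R H →ₐ[R] Matrix (Fin m) (Fin m) ℂ :=
    MonoidAlgebra.lift R (Matrix (Fin m) (Fin m) ℂ) H ((Units.coeHom _).comp ρ)
  let t : MonoidAlgebra R H := ∑ g, MonoidAlgebra.single g ⟨χ g⁻¹, hχint g⁻¹⟩
  have hφt : φ t = S := by
    simp only [t, φ, S, map_sum, MonoidAlgebra.lift_single]
    rfl
  have haint : IsIntegral R a := by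
    have : Module.Finite R (MonoidAlgebra R H) := inferInstance
    have h1 : IsIntegral R (φ t) := (IsIntegral.of_finite R t).map φ
    rw [hφt, ha, ← Algebra.algebraMap_eq_smul_one] at h1
    exact (isIntegral_algebraMap_iff (algebraMap ℂ (Matrix (Fin m) (Fin m) ℂ)).injective).1 h1
  have haint' : IsIntegral ℤ a := isIntegral_trans a haint
  have hm0 : (m : ℂ) ≠ 0 := by exact_mod_cast hm.ne'
  have haq : a = algebraMap ℚ ℂ ((Nat.card H : ℚ) / m) := by
    rw [map_div₀, map_natCast, map_natCast, hS, mul_div_cancel_right₀ _ hm0]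
  rw [haq, isIntegral_algebraMap_iff (algebraMap ℚ ℂ).injective, IsIntegrallyClosed.isIntegral_iff]
    at haint'
  obtain ⟨z, hz⟩ := haint'
  have hz' : (Nat.card H : ℤ) = z * m := by
    have hmq : (m : ℚ) ≠ 0 := by exact_mod_cast hm.ne'
    have : (z : ℚ) = (Nat.card H : ℚ) / m := hz
    rw [eq_div_iff hmq] at this
    exact_mod_cast this.symm
  exact Int.natCast_dvd_natCast.1 ⟨z, by rw [hz', mul_comm]⟩

end Dvd

end NaryGroup

/-! ### Transfer between the covering group and the `n`-ary group. -/

namespace NaryGroup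

open Matrix

section Algebra

variable {G H : Type*} [Group H] {ι : G → H} (hι : Submonoid.closure (Set.range ι) = ⊤) {m m' : ℕ}

include hι in
/-- Maps that intertwine two representations on generators of a group intertwine the
representations of the group algebra. -/
theorem intertwining_of_generators
    (Φ : MonoidAlgebra ℂ H →ₐ[ℂ] Matrix (Fin m) (Fin m) ℂ)
    (Φ' : MonoidAlgebra ℂ H →ₐ[ℂ] Matrix (Fin m') (Fin m') ℂ)
    (T : (Fin m → ℂ) →ₗ[ℂ] (Fin m' → ℂ))
    (h : ∀ x v, T (Φ (MonoidAlgebra.of ℂ H (ι x)) *ᵥ v) =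
      Φ' (MonoidAlgebra.of ℂ H (ι x)) *ᵥ T v) (a : MonoidAlgebra ℂ H) (v : Fin m → ℂ) :
    T (Φ a *ᵥ v) = Φ' a *ᵥ T v := by
  have key : ∀ (g : H) v, T (Φ (MonoidAlgebra.of ℂ H g) *ᵥ v) =
      Φ' (MonoidAlgebra.of ℂ H g) *ᵥ T v := by
    intro g
    have hg : g ∈ Submonoid.closure (Set.range ι) := hι ▸ Submonoid.mem_top g
    induction hg using Submonoid.closure_induction with
    | mem g hg => obtain ⟨x, rfl⟩ := hg; exact h x
    | one => simp [← MonoidAlgebra.one_def]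
    | mul g g' _ _ ih ih' =>
      intro v
      rw [map_mul, map_mul, map_mul, ← mulVec_mulVec, ih, ih', mulVec_mulVec]
  induction a using MonoidAlgebra.induction_on with
  | of g => exact key g v
  | add a b ha hb => rw [map_add, map_add, add_mulVec, add_mulVec, map_add, ha, hb]
  | smul r a ha => rw [map_smul, map_smul, smul_mulVec, smul_mulVec, map_smul, ha]

include hι in
/-- Subspaces that are invariant under generators of a group are invariant under the group
algebra. -/
theorem invariant_of_generators
    (Φ : MonoidAlgebra ℂ H →ₐ[ℂ] Matrix (Fin m) (Fin m) ℂ) (W : Submodule ℂ (Fin m → ℂ))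
    (h : ∀ x, ∀ v ∈ W, Φ (MonoidAlgebra.of ℂ H (ι x)) *ᵥ v ∈ W) (a : MonoidAlgebra ℂ H)
    (v : Fin m → ℂ) (hv : v ∈ W) : Φ a *ᵥ v ∈ W := by
  have key : ∀ (g : H), ∀ v ∈ W, Φ (MonoidAlgebra.of ℂ H g) *ᵥ v ∈ W := by
    intro g
    have hg : g ∈ Submonoid.closure (Set.range ι) := hι ▸ Submonoid.mem_top g
    induction hg using Submonoid.closure_induction with
    | mem g hg => obtain ⟨x, rfl⟩ := hg; exact h x
    | one => simp [← MonoidAlgebra.one_def]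
    | mul g g' _ _ ih ih' =>
      intro v hv
      rw [map_mul, map_mul, ← mulVec_mulVec]
      exact ih _ (ih' _ hv)
  induction a using MonoidAlgebra.induction_on with
  | of g => exact key g v hv
  | add a b ha hb => rw [map_add, add_mulVec]; exact W.add_mem ha hb
  | smul r a ha => rw [map_smul, smul_mulVec]; exact W.smul_mem r ha

end Algebra

section Equivalence

variable {G : Type*} {n m m' m'' : ℕ} {f : (Fin n → G) → G}

theorem _root_.NaryRep.Equivalent.symm {Λ : NaryRep f m} {Γ : NaryRep f m'} (h : Λ.Equivalent Γ) :
    Γ.Equivalent Λ := by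
  obtain ⟨T, hT⟩ := h
  refine ⟨T.symm, fun x v => ?_⟩
  rw [LinearEquiv.symm_apply_eq, hT, T.apply_symm_apply]

theorem _root_.NaryRep.Equivalent.trans {Λ : NaryRep f m} {Γ : NaryRep f m'} {Δ : NaryRep f m''}
    (h : Λ.Equivalent Γ) (h' : Γ.Equivalent Δ) : Λ.Equivalent Δ := by
  obtain ⟨T, hT⟩ := h
  obtain ⟨S, hS⟩ := h'
  exact ⟨T.trans S, fun x v => by simp [hT, hS]⟩

theorem _root_.NaryRep.Equivalent.degree_eq {Λ : NaryRep f m} {Γ : NaryRep f m'}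
    (h : Λ.Equivalent Γ) : m = m' := by
  obtain ⟨T, -⟩ := h
  simpa using T.finrank_eq

/-- Schur's lemma: a nonzero intertwining map between irreducible representations is
an equivalence. -/
theorem equivalent_of_intertwining {Λ : NaryRep f m} {Γ : NaryRep f m'} (hΛ : Λ.IsIrreducible)
    (hΓ : Γ.IsIrreducible) (T : (Fin m → ℂ) →ₗ[ℂ] (Fin m' → ℂ)) (hT0 : T ≠ 0)
    (hT : ∀ x v, T (Λ.act x v) = Γ.act x (T v)) : Λ.Equivalent Γ := by
  have hker : LinearMap.ker T = ⊥ := by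
    refine (hΛ.2 (LinearMap.ker T) fun x v hv => ?_).resolve_right fun h =>
      hT0 (LinearMap.ker_eq_top.1 h)
    rw [LinearMap.mem_ker] at hv ⊢
    rw [hT, hv]
    exact mulVec_zero _
  have hrange : LinearMap.range T = ⊤ := by
    refine (hΓ.2 (LinearMap.range T) fun x v hv => ?_).resolve_left fun h =>
      hT0 (LinearMap.range_eq_bot.1 h)
    obtain ⟨w, rfl⟩ := hv
    exact ⟨Λ.act x w, hT x w⟩
  exact ⟨LinearEquiv.ofBijective T ⟨LinearMap.ker_eq_bot.1 hker, LinearMap.range_eq_top.1 hrange⟩,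
    hT⟩

end Equivalence

/-- A finite `n`-ary group has a finite complete list of irreducible representations, for which
the sum of the squares of the degrees is the order of the covering group. -/
theorem exists_completeIrreducibleList {G : Type*} [Finite G] {n : ℕ} (f : (Fin n → G) → G)
    (hf : IsNaryGroup f) :
    ∃ (k : ℕ) (d : Fin k → ℕ) (Λ : ∀ i : Fin k, NaryRep f (d i)),
      IsCompleteIrreducibleList f d Λ ∧ ∑ i, d i ^ 2 = (n - 1) * Nat.card G := by
  obtain ⟨H, _, _, ι, hcard, hι, hop, hlift⟩ := exists_covering_group f hf
  have := Fintype.ofFinite H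
  -- Maschke's condition, which makes `ℂ[H]` semisimple.
  have : NeZero (Nat.card H : ℂ) := ⟨by simp [Nat.card_eq_fintype_card]⟩
  obtain ⟨k, d, hd, ⟨e⟩⟩ :=
    IsSemisimpleRing.exists_algEquiv_pi_matrix_of_isAlgClosed ℂ (MonoidAlgebra ℂ H)
  let Φ : ∀ i, MonoidAlgebra ℂ H →ₐ[ℂ] Matrix (Fin (d i)) (Fin (d i)) ℂ := fun i =>
    (Pi.evalAlgHom ℂ (fun i => Matrix (Fin (d i)) (Fin (d i)) ℂ) i).comp e.toAlgHom
  have hΦ : ∀ a i, Φ i a = e a i := fun a i => rfl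
  let ρ : ∀ i, H →* GL (Fin (d i)) ℂ := fun i =>
    MonoidHom.toHomUnits (((Φ i : MonoidAlgebra ℂ H →* _)).comp (MonoidAlgebra.of ℂ H))
  let Λ : ∀ i, NaryRep f (d i) := fun i =>
    { toFun := fun x => ρ i (ι x)
      map_op := fun x => by rw [hop, map_list_prod, List.map_ofFn]; rfl }
  have hΛ : ∀ i x v, (Λ i).act x v = Φ i (MonoidAlgebra.of ℂ H (ι x)) *ᵥ v := fun i x v => rfl
  have hirr : ∀ i, (Λ i).IsIrreducible := by
    refine fun i => ⟨Nat.pos_of_ne_zero (hd i).out, fun W hW => ?_⟩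
    refine eq_bot_or_eq_top_of_matrix_invariant W fun M v hv => ?_
    -- `Φ i` is onto the full matrix algebra, so `W` is invariant under every matrix `M`.
    have := invariant_of_generators hι (Φ i) W hW (e.symm (Pi.single i M)) v hv
    simpa [hΦ] using this
  refine ⟨k, d, Λ, ⟨hirr, fun i j hij ⟨T, hT⟩ => ?_, fun m Γ hΓ => ?_⟩, ?_⟩
  -- The central idempotent of the factor `i` acts as the identity on `Λ i` and as zero on `Λ j`.
  · have h := intertwining_of_generators hι (Φ i) (Φ j) T.toLinearMap (fun x v => hT x v)
      (e.symm (Pi.single i 1))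
    have h0 : ∀ v, T v = 0 := fun v => by
      have := h v
      rw [hΦ, hΦ, e.apply_symm_apply, Pi.single_eq_same, Pi.single_eq_of_ne hij.symm] at this
      simpa using this
    have : Nonempty (Fin (d i)) := ⟨⟨0, (hirr i).1⟩⟩
    obtain ⟨v, hv⟩ := exists_ne (0 : Fin (d i) → ℂ)
    exact hv (T.map_eq_zero_iff.1 (h0 v))
  · obtain ⟨σ, hσ⟩ := hlift m Γ
    let Ψ : MonoidAlgebra ℂ H →ₐ[ℂ] Matrix (Fin m) (Fin m) ℂ :=
      MonoidAlgebra.lift ℂ _ H ((Units.coeHom _).comp σ)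
    obtain ⟨i, T, hT0, hT⟩ := exists_ne_zero_intertwining_of_pi_matrix d hΓ.1
      (Ψ.comp e.symm.toAlgHom)
    refine ⟨i, NaryRep.Equivalent.symm <|
      equivalent_of_intertwining (hirr i) hΓ T hT0 fun x v => ?_⟩
    have h1 := hT (e (MonoidAlgebra.of ℂ H (ι x))) v
    have h2 : (Ψ.comp e.symm.toAlgHom) (e (MonoidAlgebra.of ℂ H (ι x))) =
        (Γ.toFun x : Matrix (Fin m) (Fin m) ℂ) := by
      simp [Ψ, hσ]
    rw [h2] at h1
    exact h1
  · rw [← hcard]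
    have h := e.toLinearEquiv.finrank_eq
    rw [Module.finrank_pi_fintype] at h
    have h2 : Module.finrank ℂ (MonoidAlgebra ℂ H) = Nat.card H := by
      rw [Nat.card_eq_fintype_card]
      exact (MonoidAlgebra.coeffLinearEquiv ℂ).finrank_eq.trans (Module.finrank_finsupp_self ℂ)
    rw [← h2, h]
    exact Finset.sum_congr rfl fun i _ => by rw [Module.finrank_matrix]; simp [sq]

/-- The degree of an irreducible representation divides the order of the covering group. -/
theorem degree_dvd {G : Type*} [Finite G] {n m : ℕ} {f : (Fin n → G) → G} (hf : IsNaryGroup f)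
    (Λ : NaryRep f m) (hΛ : Λ.IsIrreducible) : m ∣ (n - 1) * Nat.card G := by
  obtain ⟨H, _, _, ι, hcard, -, -, hlift⟩ := exists_covering_group f hf
  obtain ⟨ρ, hρ⟩ := hlift m Λ
  rw [← hcard]
  -- Invariance under `H` implies invariance under the image of `G`, so the extension to `H` stays
  -- irreducible.
  refine degree_dvd_card ρ hΛ.1 fun W hW => hΛ.2 W fun x v hv => ?_
  have := hW (ι x) v hv
  rwa [hρ] at this

/-- Two complete lists of irreducible representations have the same degrees. -/
theorem sum_degree_sq_eq {G : Type*} {n k k' : ℕ} {f : (Fin n → G) → G} {d : Fin k → ℕ}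
    {Λ : ∀ i, NaryRep f (d i)} {d' : Fin k' → ℕ} {Λ' : ∀ i, NaryRep f (d' i)}
    (h : IsCompleteIrreducibleList f d Λ) (h' : IsCompleteIrreducibleList f d' Λ') :
    ∑ i, d i ^ 2 = ∑ i, d' i ^ 2 := by
  choose φ hφ using fun i => h'.complete _ _ (h.irreducible i)
  have hinj : Function.Injective φ := by
    intro i j hij
    by_contra hne
    have h1 := hφ i
    rw [hij] at h1
    exact h.not_equivalent i j hne (NaryRep.Equivalent.trans h1 (NaryRep.Equivalent.symm (hφ j)))
  have hsurj : Function.Surjective φ := by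
    intro j
    obtain ⟨i, hi⟩ := h.complete _ _ (h'.irreducible j)
    refine ⟨i, ?_⟩
    by_contra hne
    exact h'.not_equivalent _ _ hne (NaryRep.Equivalent.symm (NaryRep.Equivalent.trans hi (hφ i)))
  exact Fintype.sum_bijective φ ⟨hinj, hsurj⟩ _ _ fun i => by
    rw [NaryRep.Equivalent.degree_eq (hφ i)]

end NaryGroup

theorem mainTheorem2 {G : Type*} [Finite G] {n : ℕ} (f : (Fin n → G) → G) (hf : IsNaryGroup f) :
    (∃ (k : ℕ) (d : Fin k → ℕ) (Λ : ∀ i : Fin k, NaryRep f (d i)),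
      IsCompleteIrreducibleList f d Λ) ∧
    ∀ (k : ℕ) (d : Fin k → ℕ) (Λ : ∀ i : Fin k, NaryRep f (d i)),
      IsCompleteIrreducibleList f d Λ →
        (∀ i, d i ∣ (n - 1) * Nat.card G) ∧ ∑ i, d i ^ 2 = (n - 1) * Nat.card G := by
  obtain ⟨k₀, d₀, Λ₀, h₀, hsum⟩ := NaryGroup.exists_completeIrreducibleList f hf
  refine ⟨⟨k₀, d₀, Λ₀, h₀⟩, fun k d Λ h => ⟨fun i => ?_, ?_⟩⟩
  · exact NaryGroup.degree_dvd hf (Λ i) (h.irreducible i)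
  · rw [NaryGroup.sum_degree_sq_eq h h₀, hsum]
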